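/- Let scalars be real or complex. Let $\kappa$ be an infinite cardinal, let $\ell^1_\kappa$ be the Banach space of absolutely summable scalar families indexed by $\kappa$, and let $X$ be a Banach space containing a closed linear subspace isomorphic to $\ell^1_\kappa$. For $c\ge 1$, call two Banach spaces $E,F$ $c$-isomorphic if there is a linear isomorphism $T$ of $E$ onto $F$ with $\|T\|\,\|T^{-1}\|\le c$. (a) Let $Z$ be a Banach space that is an $L^1$-predual, i.e. $Z^*$ is linearly isometric to $L^1(\mu)$ for some (not necessarily $\sigma$-finite) measure $\mu$, and suppose that the density character of $Z$ (the least cardinality of a dense subset) is at most $\kappa$. Then for every $\varepsilon>0$, $X^*$ contains a closed linear subspace $(1+\varepsilon)$-isomorphic to $Z^*$. (b) Consequently, for every $\varepsilon>0$, $X^*$ contains a closed linear subspace $(1+\varepsilon)$-isomorphic to $C(\{0,1\}^\kappa)^*$, where $\{0,1\}^\kappa$ carries the product topology and $C(\{0,1\}^\kappa)$ is the space of scalar-valued continuous functions with the supremum norm. -/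

import Mathlib

open scoped ENNReal

universe uK uκ uX uZ uE uF uΩ

namespace BanachEmb

/-- The density character of a topological space: the least cardinality of a dense subset. -/
noncomputable def densityCharacter (Z : Type uZ) [TopologicalSpace Z] : Cardinal.{uZ} :=
  sInf {c : Cardinal.{uZ} | ∃ s : Set Z, Dense s ∧ Cardinal.mk s = c}

/-- The Banach space `ℓ¹_κ` of all absolutely summable scalar families indexed by (the initial
ordinal of) the cardinal `κ`, with the `ℓ¹` norm. -/
abbrev EllOne (𝕜 : Type uK) [RCLike 𝕜] (κ : Cardinal.{uκ}) : Type (max uκ uK) :=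
  lp (fun _ : κ.ord.ToType => 𝕜) (1 : ℝ≥0∞)

/-- The Cantor cube `{0,1}^κ` with the product topology. -/
abbrev CantorCube (κ : Cardinal.{uκ}) : Type uκ :=
  κ.ord.ToType → Bool

/-- `X` contains a (closed linear) subspace isomorphic to `E`. -/
def ContainsIsomorph (𝕜 : Type uK) [RCLike 𝕜]
    (X : Type uX) [NormedAddCommGroup X] [NormedSpace 𝕜 X]
    (E : Type uE) [NormedAddCommGroup E] [NormedSpace 𝕜 E] : Prop :=
  ∃ Y : Submodule 𝕜 X, IsClosed (Y : Set X) ∧ Nonempty (Y ≃L[𝕜] E)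

/-- `E` and `F` are `c`-isomorphic: there is a surjective linear isomorphism `T : E → F`
with `‖T‖ * ‖T⁻¹‖ ≤ c`. -/
def AreIsomorphicWithConst (𝕜 : Type uK) [RCLike 𝕜] (c : ℝ)
    (E : Type uE) [NormedAddCommGroup E] [NormedSpace 𝕜 E]
    (F : Type uF) [NormedAddCommGroup F] [NormedSpace 𝕜 F] : Prop :=
  ∃ T : E ≃L[𝕜] F, ‖(T : E →L[𝕜] F)‖ * ‖(T.symm : F →L[𝕜] E)‖ ≤ c

/-- `X` contains a (closed linear) subspace `c`-isomorphic to `E`. -/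
def ContainsIsomorphWithConst (𝕜 : Type uK) [RCLike 𝕜] (c : ℝ)
    (X : Type uX) [NormedAddCommGroup X] [NormedSpace 𝕜 X]
    (E : Type uE) [NormedAddCommGroup E] [NormedSpace 𝕜 E] : Prop :=
  ∃ Y : Submodule 𝕜 X, IsClosed (Y : Set X) ∧ AreIsomorphicWithConst 𝕜 c Y E

/-- `Z` is an `L¹`-predual: its dual is (linearly) isometric to `L¹(μ)` for some measure `μ`,
not necessarily `σ`-finite. The universe `vΩ` of the underlying measurable space is explicit. -/
def IsL1Predual.{vΩ, vK, vZ} (𝕜 : Type vK) [RCLike 𝕜]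
    (Z : Type vZ) [NormedAddCommGroup Z] [NormedSpace 𝕜 Z] : Prop :=
  ∃ (Ω : Type vΩ) (_ : MeasurableSpace Ω) (μ : MeasureTheory.Measure Ω),
    Nonempty (StrongDual 𝕜 Z ≃ₗᵢ[𝕜] MeasureTheory.Lp 𝕜 1 μ)

end BanachEmb

/-!
The space `X` contains, for each `δ > 0`, a family `(yᵢ)` of `κ` vectors of norm at most one with
`‖∑ aᵢ yᵢ‖ ≥ (1 + δ)⁻¹ ∑ |aᵢ|`: this is James' distortion theorem, valid for every infinite
cardinal (`exists_almost_isometric_ellOne_family`). As `Z` has density at most `κ`, its unit ball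
contains a norming family `(zᵢ)` indexed by `κ`, and `yᵢ ↦ zᵢ` defines an operator `q` of norm at
most `1 + δ` from the span of the `yᵢ` to `Z`.

Suppose that `q`, followed by the embedding of `Z` in `Z**`, extends to `T : X → Z**` with norm at
most `‖q‖` (`BidualExtension`). The operator `S : Z* → X*`, `S φ x = T x φ`, has norm at most
`1 + δ`, and `‖S φ‖ ≥ |S φ yᵢ| = |φ zᵢ|` for all `i`, hence `‖S φ‖ ≥ ‖φ‖`. So `S` is the embedding
(`containsIsomorphWithConst_of_bidualExtension`).

The extension property is the injectivity of `Z**`. For `Z* = L¹(μ)`, an operator `E → Z**` is a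
functional on the Bochner space `L¹(μ, E)`, which embeds isometrically in `L¹(μ, X)`, so that the
Hahn–Banach theorem applies (`bidualExtension_of_dual_isometric_L1`). For `Z = C({0,1}^κ)` it is
obtained directly, without representing the dual by measures: functions of finitely many
coordinates form spaces `ℓ^∞_n`, which are injective, and one passes to a limit in `Z**`
(`bidualExtension_continuousMap_cube`).
-/

namespace BanachEmb

open Filter Topology MeasureTheory

/-! ### Bidual extension for `L¹`-preduals -/

/-- Every operator from a subspace of `X` into `Z` extends, with the same norm, to an operator
from `X` into `Z**`. The extension `T` is encoded by `S : Z* → X*`, `S φ x = T x φ`. -/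
def BidualExtension (𝕜 : Type*) [RCLike 𝕜]
    (X : Type*) [NormedAddCommGroup X] [NormedSpace 𝕜 X]
    (Z : Type*) [NormedAddCommGroup Z] [NormedSpace 𝕜 Z] : Prop :=
  ∀ (E : Submodule 𝕜 X) (q : E →L[𝕜] Z),
    ∃ S : StrongDual 𝕜 Z →L[𝕜] StrongDual 𝕜 X, ‖S‖ ≤ ‖q‖ ∧ ∀ φ (e : E), S φ e = φ (q e)

variable {𝕜 : Type*} [RCLike 𝕜]
  {X : Type*} [NormedAddCommGroup X] [NormedSpace 𝕜 X]
  {Z : Type*} [NormedAddCommGroup Z] [NormedSpace 𝕜 Z]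

/-- A bounded bilinear form on `L¹(μ) × E` linearizes, with the same norm, to a functional on the
Bochner space `L¹(μ, E)`; the class of `f(·)e` plays the role of the tensor `f ⊗ e`. -/
lemma exists_linearization_on_L1 {Ω : Type*} [MeasurableSpace Ω] {μ : Measure Ω}
    {E : Type*} [NormedAddCommGroup E] [NormedSpace 𝕜 E]
    (B : Lp 𝕜 1 μ →L[𝕜] StrongDual 𝕜 E) :
    ∃ Φ : StrongDual 𝕜 (Lp E 1 μ), ‖Φ‖ ≤ ‖B‖ ∧
      ∀ (f : Lp 𝕜 1 μ) (e : E), Φ ((ContinuousLinearMap.toSpanSingleton 𝕜 e).compLp f) = B f e := by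
  classical
  let _ : NormedSpace ℝ E := NormedSpace.restrictScalars ℝ 𝕜 E
  have : IsScalarTower ℝ 𝕜 E := RestrictScalars.isScalarTower ℝ 𝕜 E
  -- The vector measure `s ↦ B 1_s`, with the irrelevant value `0` where `1_s` is not in `L¹`.
  let T : Set Ω → E →L[ℝ] 𝕜 := fun s =>
    if h : MeasurableSet s ∧ μ s ≠ ∞ then
      (B (indicatorConstLp 1 h.1 h.2 1)).restrictScalars ℝ else 0
  have hTs : ∀ s (h : MeasurableSet s ∧ μ s ≠ ∞),
      T s = (B (indicatorConstLp 1 h.1 h.2 1)).restrictScalars ℝ := fun s h => dif_pos h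
  have hT : DominatedFinMeasAdditive μ T ‖B‖ := by
    refine ⟨fun s t hs ht hμs hμt hst => ?_, fun s hs hμs => ?_⟩
    · rw [hTs s ⟨hs, hμs⟩, hTs t ⟨ht, hμt⟩, hTs (s ∪ t) ⟨hs.union ht, by finiteness⟩,
        indicatorConstLp_disjoint_union hs ht hμs hμt hst]
      ext e
      simp
    · rw [hTs s ⟨hs, hμs.ne⟩, ContinuousLinearMap.norm_restrictScalars]
      refine (B.le_opNorm _).trans ?_
      rw [norm_indicatorConstLp one_ne_zero ENNReal.one_ne_top]
      simp
  have hsmul : ∀ c : 𝕜, ∀ s x, T s (c • x) = c • T s x := by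
    intro c s x
    by_cases h : MeasurableSet s ∧ μ s ≠ ∞
    · simp [hTs s h]
    · simp [T, dif_neg h]
  refine ⟨L1.setToL1' 𝕜 hT hsmul, ?_, fun f e => ?_⟩
  · refine ContinuousLinearMap.opNorm_le_bound _ (norm_nonneg B) fun f => ?_
    rw [← L1.setToL1_eq_setToL1']
    exact L1.norm_setToL1_le_mul_norm hT (norm_nonneg B) f
  · let L := ContinuousLinearMap.toSpanSingleton 𝕜 e
    change L1.setToL1' 𝕜 hT hsmul (L.compLpL 1 μ f) = B f e
    refine Lp.induction ENNReal.one_ne_top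
      (motive := fun f => L1.setToL1' 𝕜 hT hsmul (L.compLpL 1 μ f) = B f e) ?_ ?_ ?_ f
    · intro c s hs hμs
      have h1 : L.compLpL 1 μ (indicatorConstLp 1 hs hμs.ne c) =
          indicatorConstLp 1 hs hμs.ne (c • e) := by
        ext1
        filter_upwards [L.coeFn_compLpL (indicatorConstLp 1 hs hμs.ne c),
          indicatorConstLp_coeFn (p := 1) (hs := hs) (hμs := hμs.ne) (c := c),
          indicatorConstLp_coeFn (p := 1) (hs := hs) (hμs := hμs.ne) (c := c • e)] with x h1 h2 h3
        rw [h1, h2, h3]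
        by_cases hx : x ∈ s <;> simp [hx, L]
      have h2 : indicatorConstLp 1 hs hμs.ne c
          = c • (indicatorConstLp 1 hs hμs.ne (1 : 𝕜) : Lp 𝕜 1 μ) := by
        ext1
        filter_upwards [Lp.coeFn_smul c (indicatorConstLp 1 hs hμs.ne (1 : 𝕜)),
          indicatorConstLp_coeFn (p := 1) (hs := hs) (hμs := hμs.ne) (c := c),
          indicatorConstLp_coeFn (p := 1) (hs := hs) (hμs := hμs.ne) (c := (1 : 𝕜))] with x h1 h2 h3
        rw [h1, h2, Pi.smul_apply, h3]
        by_cases hx : x ∈ s <;> simp [hx]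
      rw [Lp.simpleFunc.coe_indicatorConst, h1, ← L1.setToL1_eq_setToL1',
        L1.setToL1_indicatorConstLp, hsmul, hTs s ⟨hs, hμs.ne⟩, h2]
      simp
    · intro f g hf hg _ h1 h2
      simp only [map_add, h1, h2, add_apply]
    · refine isClosed_eq ?_ ?_
      · fun_prop
      · fun_prop

lemma norm_subtype_compLpL {Ω : Type*} [MeasurableSpace Ω] {μ : Measure Ω}
    (E : Submodule 𝕜 X) (f : Lp E 1 μ) : ‖E.subtypeL.compLpL 1 μ f‖ = ‖f‖ := by
  apply le_antisymm
  · refine Lp.norm_le_norm_of_ae_le ?_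
    filter_upwards [E.subtypeL.coeFn_compLpL f] with x hx
    rw [hx]; simp
  · refine Lp.norm_le_norm_of_ae_le ?_
    filter_upwards [E.subtypeL.coeFn_compLpL f] with x hx
    rw [hx]; simp

/-- The inclusion `L¹(μ, E) ⊆ L¹(μ, X)` is isometric, so the functional on `L¹(μ, E)` given by
`q : E → Z` and `Z* = L¹(μ)` extends by the Hahn–Banach theorem. No `σ`-finiteness is needed. -/
theorem bidualExtension_of_dual_isometric_L1 {Ω : Type*} [MeasurableSpace Ω] {μ : Measure Ω}
    (I : StrongDual 𝕜 Z ≃ₗᵢ[𝕜] Lp 𝕜 1 μ) : BidualExtension 𝕜 X Z := by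
  intro E q
  let B : Lp 𝕜 1 μ →L[𝕜] StrongDual 𝕜 E :=
    ((ContinuousLinearMap.compL 𝕜 E Z 𝕜).flip q).comp
      (I.symm.toContinuousLinearEquiv : Lp 𝕜 1 μ →L[𝕜] StrongDual 𝕜 Z)
  have hB : ∀ f, B f = (I.symm f).comp q := fun f => rfl
  have hBn : ‖B‖ ≤ ‖q‖ := by
    refine ContinuousLinearMap.opNorm_le_bound _ (norm_nonneg _) fun f => ?_
    rw [hB, mul_comm]
    exact (ContinuousLinearMap.opNorm_comp_le _ _).trans_eq (by rw [I.symm.norm_map])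
  obtain ⟨Φ, hΦ, hΦB⟩ := exists_linearization_on_L1 B
  let J : Lp E 1 μ →ₗᵢ[𝕜] Lp X 1 μ :=
    ⟨(E.subtypeL.compLpL 1 μ : Lp E 1 μ →ₗ[𝕜] Lp X 1 μ), norm_subtype_compLpL E⟩
  let JE := J.equivRange
  obtain ⟨Ψ, hΨ, hΨn⟩ := exists_extension_norm_eq (LinearMap.range J.toLinearMap)
    (Φ.comp (JE.symm.toContinuousLinearEquiv :
      LinearMap.range J.toLinearMap →L[𝕜] Lp E 1 μ))
  have hΨJ : ∀ g : Lp E 1 μ, Ψ (J g) = Φ g := by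
    intro g
    refine (hΨ (JE g)).trans ?_
    simp
  have hΨle : ‖Ψ‖ ≤ ‖q‖ := by
    rw [hΨn]
    refine ContinuousLinearMap.opNorm_le_bound _ (norm_nonneg _) fun g => ?_
    have h := Φ.le_opNorm (JE.symm g)
    rw [JE.symm.norm_map] at h
    exact h.trans (by gcongr; exact hΦ.trans hBn)
  let S₀ : StrongDual 𝕜 Z →ₗ[𝕜] X →ₗ[𝕜] 𝕜 := LinearMap.mk₂ 𝕜
    (fun φ x => Ψ ((ContinuousLinearMap.toSpanSingleton 𝕜 x).compLpL 1 μ (I φ)))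
    (fun φ ψ x => by simp only [map_add])
    (fun c φ x => by simp only [map_smul])
    (fun φ x y => by
      rw [ContinuousLinearMap.toSpanSingleton_add, ContinuousLinearMap.add_compLpL]
      simp)
    (fun c φ x => by
      rw [ContinuousLinearMap.toSpanSingleton_smul, ContinuousLinearMap.smul_compLpL]
      simp)
  have hS₀ : ∀ φ x, ‖S₀ φ x‖ ≤ ‖q‖ * ‖φ‖ * ‖x‖ := by
    intro φ x
    have h1 : ‖(ContinuousLinearMap.toSpanSingleton 𝕜 x).compLpL 1 μ (I φ)‖ ≤ ‖x‖ * ‖φ‖ := by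
      refine (ContinuousLinearMap.norm_compLp_le _ _).trans_eq ?_
      rw [I.norm_map, ContinuousLinearMap.norm_toSpanSingleton]
    calc ‖S₀ φ x‖ ≤ ‖Ψ‖ * _ := Ψ.le_opNorm _
      _ ≤ ‖q‖ * (‖x‖ * ‖φ‖) := by gcongr
      _ = _ := by ring
  refine ⟨LinearMap.mkContinuous₂ S₀ ‖q‖ hS₀,
    LinearMap.mkContinuous₂_norm_le _ (norm_nonneg _) _, fun φ e => ?_⟩
  have h1 : (ContinuousLinearMap.toSpanSingleton 𝕜 (e : X)).compLpL 1 μ (I φ) =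
      J ((ContinuousLinearMap.toSpanSingleton 𝕜 e).compLp (I φ)) := by
    change _ = E.subtypeL.compLpL 1 μ ((ContinuousLinearMap.toSpanSingleton 𝕜 e).compLp (I φ))
    ext1
    filter_upwards [(ContinuousLinearMap.toSpanSingleton 𝕜 (e : X)).coeFn_compLpL (I φ),
      E.subtypeL.coeFn_compLpL ((ContinuousLinearMap.toSpanSingleton 𝕜 e).compLp (I φ)),
      (ContinuousLinearMap.toSpanSingleton 𝕜 e).coeFn_compLp (I φ)] with x h1 h2 h3
    rw [h1, h2, h3]
    simp
  change Ψ ((ContinuousLinearMap.toSpanSingleton 𝕜 (e : X)).compLpL 1 μ (I φ)) = _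
  rw [h1, hΨJ, hΦB, hB]
  simp

/-! ### Bidual extension for `C({0,1}^ι)` -/

/-- If uniformly bounded operators `T j : X → Z` converge on `E` to `q`, a weak-star cluster point
of them in the operators `X → Z**` extends `q`. -/
lemma exists_extension_of_tendsto {J : Type*} (l : Filter J) [l.NeBot] (E : Submodule 𝕜 X)
    (q : E →L[𝕜] Z) (T : J → X →ₗ[𝕜] Z) {C : ℝ} (hC : 0 ≤ C) (hT : ∀ j x, ‖T j x‖ ≤ C * ‖x‖)
    (hq : ∀ e : E, Tendsto (fun j => T j e) l (𝓝 (q e))) :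
    ∃ S : StrongDual 𝕜 Z →L[𝕜] StrongDual 𝕜 X, ‖S‖ ≤ C ∧ ∀ φ (e : E), S φ e = φ (q e) := by
  have hb : ∀ (φ : StrongDual 𝕜 Z) j x, ‖φ (T j x)‖ ≤ C * ‖φ‖ * ‖x‖ := fun φ j x =>
    calc ‖φ (T j x)‖ ≤ ‖φ‖ * ‖T j x‖ := φ.le_opNorm _
      _ ≤ ‖φ‖ * (C * ‖x‖) := by gcongr; exact hT j x
      _ = _ := by ring
  have hlim : ∀ (φ : StrongDual 𝕜 Z) (x : X), ∃ c : 𝕜,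
      Tendsto (fun j => φ (T j x)) (Ultrafilter.of l) (𝓝 c) := by
    intro φ x
    obtain ⟨c, -, hc⟩ := (isCompact_closedBall (0 : 𝕜) (C * ‖φ‖ * ‖x‖)).ultrafilter_le_nhds
      ((Ultrafilter.of l).map fun j => φ (T j x)) (by
        rw [le_principal_iff]
        exact Filter.Eventually.of_forall (f := (Ultrafilter.of l : Filter J)) fun j => by simpa using hb φ j x)
    exact ⟨c, hc⟩
  choose s hs using hlim
  let S₀ : StrongDual 𝕜 Z →ₗ[𝕜] X →ₗ[𝕜] 𝕜 := LinearMap.mk₂ 𝕜 s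
    (fun φ ψ x => tendsto_nhds_unique (hs _ _) (by simpa using (hs φ x).add (hs ψ x)))
    (fun c φ x => tendsto_nhds_unique (hs _ _) (by simpa using (hs φ x).const_mul c))
    (fun φ x y => tendsto_nhds_unique (hs _ _) (by simpa using (hs φ x).add (hs φ y)))
    (fun c φ x => tendsto_nhds_unique (hs _ _) (by simpa using (hs φ x).const_mul c))
  have hS₀ : ∀ φ x, ‖S₀ φ x‖ ≤ C * ‖φ‖ * ‖x‖ := fun φ x =>
    le_of_tendsto (hs φ x).norm (Eventually.of_forall fun j => hb φ j x)
  refine ⟨LinearMap.mkContinuous₂ S₀ C hS₀, LinearMap.mkContinuous₂_norm_le _ hC _, fun φ e => ?_⟩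
  refine tendsto_nhds_unique (hs φ e) ?_
  exact ((φ.continuous.tendsto _).comp (hq e)).mono_left (Ultrafilter.of_le l)

open Classical in
/-- The retraction of the cube `{0,1}^ι` that sets all coordinates outside `F` to `0`. -/
noncomputable def truncate {ι : Type*} (F : Finset ι) (ω : ι → Bool) : ι → Bool :=
  fun i => if i ∈ F then ω i else false

/-- Truncation factors through the finite discrete space `{0,1}^F`. -/
lemma truncate_eq_comp {ι : Type*} (F : Finset ι) :
    ∃ ext : (F → Bool) → (ι → Bool), truncate F = ext ∘ fun ω i => ω i := by
  classical
  refine ⟨fun η i => if h : i ∈ F then η ⟨i, h⟩ else false, ?_⟩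
  ext ω i
  by_cases h : i ∈ F <;> simp [truncate, h]

lemma continuous_comp_truncate {ι Y : Type*} [TopologicalSpace Y] (F : Finset ι)
    (g : (ι → Bool) → Y) : Continuous fun ω => g (truncate F ω) := by
  obtain ⟨ext, h⟩ := truncate_eq_comp F
  rw [h]
  exact (continuous_of_discreteTopology (f := g ∘ ext)).comp
    (continuous_pi fun i => continuous_apply _)

lemma tendstoUniformly_comp_truncate {ι : Type*} (f : C(ι → Bool, 𝕜)) :
    TendstoUniformly (fun (F : Finset ι) ω => f (truncate F ω)) f atTop := by
  have h : TendstoUniformly (fun (F : Finset ι) ω => truncate F ω) id atTop := by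
    rw [tendstoUniformly_iff_tendsto, Pi.uniformity, tendsto_iInf]
    intro i
    rw [tendsto_comap_iff]
    refine Tendsto.mono_right ?_ refl_le_uniformity
    rw [tendsto_principal]
    have : ∀ᶠ F : Finset ι in atTop, i ∈ F :=
      (eventually_ge_atTop {i}).mono fun F hF => hF (by simp)
    refine (this.prod_inl _).mono fun p hp => ?_
    simp [truncate, hp]
  exact (CompactSpace.uniformContinuous_of_continuous f.continuous).comp_tendstoUniformly h

/-- `C({0,1}^ι)` is the closure of the union of the spaces of functions depending on the coordinates
in a finite set `F`. Each is a finite-dimensional `ℓ^∞`, into which operators extend by the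
Hahn–Banach theorem one point at a time. -/
theorem bidualExtension_continuousMap_cube (ι : Type*) :
    BidualExtension 𝕜 X C(ι → Bool, 𝕜) := by
  intro E q
  have hext : ∀ ω : ι → Bool, ∃ ψ : StrongDual 𝕜 X, ‖ψ‖ ≤ ‖q‖ ∧ ∀ e : E, ψ e = q e ω := by
    intro ω
    obtain ⟨ψ, h1, h2⟩ := exists_extension_norm_eq E ((ContinuousMap.evalCLM 𝕜 ω).comp q)
    refine ⟨ψ, ?_, fun e => h1 e⟩
    rw [h2]
    refine ContinuousLinearMap.opNorm_le_bound _ (norm_nonneg _) fun e => ?_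
    exact ((q e).norm_coe_le_norm ω).trans (q.le_opNorm e)
  choose ψ hψ hψe using hext
  let T : Finset ι → X →ₗ[𝕜] C(ι → Bool, 𝕜) := fun F =>
    { toFun := fun x => ⟨fun ω => ψ (truncate F ω) x, continuous_comp_truncate F (ψ · x)⟩
      map_add' := fun x y => by ext; simp
      map_smul' := fun c x => by ext; simp }
  refine exists_extension_of_tendsto atTop E q T (norm_nonneg _) (fun F x => ?_) fun e => ?_
  · refine (ContinuousMap.norm_le _ (by positivity)).2 fun ω => ?_
    exact (ψ _).le_of_opNorm_le (hψ _) x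
  · rw [ContinuousMap.tendsto_iff_tendstoUniformly]
    have h : ∀ F, ⇑(T F e) = fun ω => q e (truncate F ω) := fun F => funext fun ω => hψe _ e
    simpa only [h] using tendstoUniformly_comp_truncate (q e)

/-- Functions of finitely many coordinates with values in a countable dense set of scalars. -/
lemma exists_dense_range_continuousMap_cube (ι : Type*) [Infinite ι] :
    ∃ d : ι → C(ι → Bool, 𝕜), DenseRange d := by
  classical
  let Q := TopologicalSpace.denseSeq 𝕜
  have hQ : DenseRange Q := TopologicalSpace.denseRange_denseSeq 𝕜
  let D : (Σ F : Finset ι, ((F → Bool) → ℕ)) → C(ι → Bool, 𝕜) := fun p =>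
    ⟨fun ω => Q (p.2 fun i => ω i), (continuous_of_discreteTopology (f := fun η => Q (p.2 η))).comp
      (continuous_pi fun i => continuous_apply _)⟩
  have hD : DenseRange D := by
    rw [Metric.denseRange_iff]
    intro f ε hε
    have h1 := (Metric.tendstoUniformly_iff.1 (tendstoUniformly_comp_truncate f) (ε / 2)
      (half_pos hε)).exists
    obtain ⟨F, hF⟩ := h1
    obtain ⟨ext, hx⟩ := truncate_eq_comp F
    choose n hn using fun η : F → Bool => Metric.denseRange_iff.1 hQ (f (ext η)) (ε / 2) (half_pos hε)
    refine ⟨⟨F, n⟩, ?_⟩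
    refine (ContinuousMap.dist_lt_iff hε).2 fun ω => ?_
    have h2 := hF ω
    rw [hx] at h2
    calc _ ≤ _ := dist_triangle _ (f (ext fun i => ω i)) _
      _ < ε / 2 + ε / 2 := add_lt_add h2 (hn _)
      _ = ε := add_halves ε
  have hcard : Cardinal.mk (Σ F : Finset ι, ((F → Bool) → ℕ)) ≤ Cardinal.mk ι := by
    rw [Cardinal.mk_sigma]
    refine (Cardinal.sum_le_sum _ (fun _ => Cardinal.aleph0) fun F => Cardinal.mk_le_aleph0).trans ?_
    rw [Cardinal.sum_const', Cardinal.mk_finset_of_infinite,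
      Cardinal.mul_aleph0_eq (Cardinal.aleph0_le_mk ι)]
  obtain ⟨j⟩ := hcard
  have : Nonempty (Σ F : Finset ι, ((F → Bool) → ℕ)) := ⟨⟨∅, fun _ => 0⟩⟩
  refine ⟨D ∘ Function.invFun j, ?_⟩
  rwa [DenseRange, (Function.invFun_surjective j.injective).range_comp]

/-! ### James distortion for `ℓ¹_κ` -/

/-- The `ℓ¹`-norm `∑ |aᵢ|` of a finitely supported family. -/
noncomputable def ellOneNorm {ι : Type*} (a : ι →₀ 𝕜) : ℝ := ∑ i ∈ a.support, ‖a i‖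

section ellOneNorm

variable {ι : Type*}

lemma ellOneNorm_nonneg (a : ι →₀ 𝕜) : 0 ≤ ellOneNorm a := by
  unfold ellOneNorm; positivity

lemma ellOneNorm_eq_sum {a : ι →₀ 𝕜} {s : Finset ι} (h : a.support ⊆ s) :
    ellOneNorm a = ∑ i ∈ s, ‖a i‖ :=
  Finset.sum_subset h fun i _ hi => by simpa using hi

lemma norm_le_ellOneNorm (a : ι →₀ 𝕜) (i : ι) : ‖a i‖ ≤ ellOneNorm a := by
  by_cases h : i ∈ a.support
  · exact Finset.single_le_sum (f := fun i => ‖a i‖) (fun _ _ => norm_nonneg _) h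
  · rw [Finsupp.notMem_support_iff.1 h, norm_zero]
    exact ellOneNorm_nonneg a

lemma ellOneNorm_smul (c : 𝕜) (a : ι →₀ 𝕜) : ellOneNorm (c • a) = ‖c‖ * ellOneNorm a := by
  rw [ellOneNorm_eq_sum (Finsupp.support_smul (b := c) (g := a)), ellOneNorm, Finset.mul_sum]
  simp

lemma ellOneNorm_add {a b : ι →₀ 𝕜} (h : Disjoint a.support b.support) :
    ellOneNorm (a + b) = ellOneNorm a + ellOneNorm b := by
  classical
  rw [ellOneNorm_eq_sum (Finsupp.support_add (g₁ := a) (g₂ := b)), Finset.sum_union h,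
    ellOneNorm, ellOneNorm]
  congr 1 <;> refine Finset.sum_congr rfl fun i hi => ?_
  · rw [Finsupp.add_apply, Finsupp.notMem_support_iff.1 (Finset.disjoint_left.1 h hi), add_zero]
  · rw [Finsupp.add_apply, Finsupp.notMem_support_iff.1 (Finset.disjoint_right.1 h hi), zero_add]

lemma support_sum_smul_disjoint {α : Type*} {g : α → ι →₀ 𝕜} {A : Set ι} {s : Finset α}
    (h : ∀ i ∈ s, Disjoint ((g i).support : Set ι) A) (b : α → 𝕜) :
    Disjoint ((∑ i ∈ s, b i • g i).support : Set ι) A := by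
  rw [Set.disjoint_left]
  intro j hj hjA
  refine (Finsupp.mem_support_iff.1 hj) ?_
  rw [Finsupp.finsetSum_apply]
  refine Finset.sum_eq_zero fun i hi => ?_
  rw [Finsupp.smul_apply, Finsupp.notMem_support_iff.1 (fun h' =>
    Set.disjoint_left.1 (h i hi) h' hjA), smul_zero]

lemma ellOneNorm_sum_smul {α : Type*} {g : α → ι →₀ 𝕜}
    (h : Pairwise fun i j => Disjoint (g i).support (g j).support) (b : α → 𝕜) (s : Finset α) :
    ellOneNorm (∑ i ∈ s, b i • g i) = ∑ i ∈ s, ‖b i‖ * ellOneNorm (g i) := by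
  classical
  induction s using Finset.induction_on with
  | empty => simp [ellOneNorm]
  | insert i s hi ih =>
    rw [Finset.sum_insert hi, Finset.sum_insert hi, ellOneNorm_add, ih, ellOneNorm_smul]
    refine Disjoint.mono_left Finsupp.support_smul (Disjoint.symm ?_)
    rw [← Finset.disjoint_coe]
    refine support_sum_smul_disjoint (fun j hj => ?_) b
    exact Finset.disjoint_coe.2 (h fun hij => hi (hij ▸ hj))

end ellOneNorm

/-- Transfinite recursion along `κ.ord`: if a property `P` is satisfied off every set of fewer than
`κ` indices, then `κ` many disjointly supported families satisfy it. Fewer than `κ` finite supports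
have union of size less than `κ`, so the construction never stops; no regularity of `κ` is used. -/
lemma exists_disjoint_support_family {κ : Cardinal} (hκ : Cardinal.aleph0 ≤ κ)
    {A₀ : Set κ.ord.ToType} (hA₀ : Cardinal.mk A₀ < κ) {P : (κ.ord.ToType →₀ 𝕜) → Prop}
    (h : ∀ A : Set κ.ord.ToType, Cardinal.mk A < κ →
      ∃ a : κ.ord.ToType →₀ 𝕜, P a ∧ Disjoint (a.support : Set κ.ord.ToType) A) :
    ∃ g : κ.ord.ToType → (κ.ord.ToType →₀ 𝕜), (∀ i, P (g i)) ∧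
      (∀ i, Disjoint ((g i).support : Set κ.ord.ToType) A₀) ∧
      Pairwise fun i j => Disjoint (g i).support (g j).support := by
  classical
  choose! pick hP hdisj using h
  let F : ∀ i : κ.ord.ToType, (∀ j, j < i → (κ.ord.ToType →₀ 𝕜)) → (κ.ord.ToType →₀ 𝕜) :=
    fun i r => pick (A₀ ∪ ⋃ j : Set.Iio i, ((r j j.2).support : Set κ.ord.ToType))
  let g : κ.ord.ToType → (κ.ord.ToType →₀ 𝕜) := IsWellFounded.fix (· < ·) F
  have hg : ∀ i, g i = pick (A₀ ∪ ⋃ j : Set.Iio i, ((g j.1).support : Set κ.ord.ToType)) :=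
    fun i => IsWellFounded.fix_eq (· < ·) F i
  have hcard : ∀ i, Cardinal.mk
      (A₀ ∪ ⋃ j : Set.Iio i, ((g j.1).support : Set κ.ord.ToType) : Set κ.ord.ToType) < κ := by
    intro i
    refine (Cardinal.mk_union_le _ _).trans_lt (Cardinal.add_lt_of_lt hκ hA₀ ?_)
    have hi : Cardinal.mk (Set.Iio i) < κ := by
      simpa using Cardinal.mk_Iio_lt i (by simp)
    rcases Set.finite_or_infinite (Set.Iio i) with hfin | hinf
    · have := hfin.to_subtype
      exact (Set.finite_iUnion fun j => Finset.finite_toSet _).lt_aleph0.trans_le hκ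
    · have := hinf.to_subtype
      refine Cardinal.mk_iUnion_le_sum_mk.trans_lt (lt_of_le_of_lt ?_ hi)
      refine (Cardinal.sum_le_sum _ (fun _ => Cardinal.aleph0) fun j =>
        (Finset.finite_toSet _).lt_aleph0.le).trans ?_
      rw [Cardinal.sum_const', Cardinal.mul_aleph0_eq (Cardinal.aleph0_le_mk _)]
  have hd : ∀ i, Disjoint ((g i).support : Set κ.ord.ToType)
      (A₀ ∪ ⋃ j : Set.Iio i, ((g j.1).support : Set κ.ord.ToType)) := by
    intro i
    have h := hdisj _ (hcard i)
    rwa [← hg i] at h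
  have hlt : ∀ i j, j < i → Disjoint (g i).support (g j).support := fun i j hji =>
    Finset.disjoint_coe.1 ((hd i).mono_right fun x hx =>
      Or.inr (Set.mem_iUnion.2 ⟨⟨j, hji⟩, hx⟩))
  refine ⟨g, fun i => ?_, fun i => (hd i).mono_right Set.subset_union_left, fun i j hij => ?_⟩
  · rw [hg i]
    exact hP _ (hcard i)
  · rcases hij.lt_or_gt with h | h
    · exact (hlt j i h).symm
    · exact hlt i j h

/-- James' distortion theorem for `ℓ¹_κ`: a family equivalent to the unit vector basis has blocks
that are almost isometrically equivalent to it. -/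
theorem exists_almost_isometric_ellOne_family {κ : Cardinal} (hκ : Cardinal.aleph0 ≤ κ)
    {v : κ.ord.ToType → X} {m M : ℝ} (hm : 0 < m)
    (hlow : ∀ a : κ.ord.ToType →₀ 𝕜, m * ellOneNorm a ≤ ‖Finsupp.linearCombination 𝕜 v a‖)
    (hup : ∀ i, ‖v i‖ ≤ M) {c : ℝ} (hc : c < 1) :
    ∃ y : κ.ord.ToType → X, (∀ i, ‖y i‖ ≤ 1) ∧
      ∀ a : κ.ord.ToType →₀ 𝕜, c * ellOneNorm a ≤ ‖Finsupp.linearCombination 𝕜 y a‖ := by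
  classical
  let L := Finsupp.linearCombination 𝕜 v
  -- `sSup Γ` is the best lower `ℓ¹`-constant obtainable by discarding fewer than `κ` indices.
  let Γ : Set ℝ := {r | ∃ A : Set κ.ord.ToType, Cardinal.mk A < κ ∧
    ∀ a : κ.ord.ToType →₀ 𝕜, Disjoint (a.support : Set κ.ord.ToType) A → r * ellOneNorm a ≤ ‖L a‖}
  have hmΓ : m ∈ Γ := ⟨∅, by simpa using Cardinal.aleph0_pos.trans_le hκ, fun a _ => hlow a⟩
  have hbdd : BddAbove Γ := by
    refine ⟨M, ?_⟩
    rintro r ⟨A, hA, hr⟩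
    obtain ⟨i, hi⟩ : ∃ i, i ∉ A := by
      by_contra! hall
      rw [Set.eq_univ_of_forall hall, Cardinal.mk_univ, Cardinal.mk_ord_toType] at hA
      exact lt_irrefl _ hA
    have h1 := hr (Finsupp.single i 1) (by
      rw [Finsupp.support_single i one_ne_zero]; simpa using hi)
    simp only [ellOneNorm, Finsupp.support_single i (one_ne_zero : (1 : 𝕜) ≠ 0), L,
      Finset.sum_singleton, Finsupp.single_eq_same, norm_one, mul_one,
      Finsupp.linearCombination_single, one_smul] at h1
    exact h1.trans (hup i)
  have hK : 0 < sSup Γ := hm.trans_le (le_csSup hbdd hmΓ)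
  obtain ⟨K', hK', hcK⟩ : ∃ K', sSup Γ < K' ∧ c * K' < sSup Γ := by
    have h : Tendsto (fun t => c * t) (𝓝[>] sSup Γ) (𝓝 (c * sSup Γ)) :=
      ((continuous_const_mul c).tendsto _).mono_left nhdsWithin_le_nhds
    have h1 := h.eventually_lt_const (u := sSup Γ) (by nlinarith)
    exact ((eventually_mem_nhdsWithin (a := sSup Γ) (s := Set.Ioi (sSup Γ))).and h1).exists
  have hK'0 : 0 < K' := hK.trans hK'
  obtain ⟨r, ⟨A₀, hA₀, hr⟩, hcr⟩ := exists_lt_of_lt_csSup ⟨m, hmΓ⟩ hcK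
  -- As `K'` exceeds the supremum, off every small set it fails to be a lower constant: the
  -- blocks `g i` witness this. Being supported off `A₀`, they still have the lower constant `r`.
  obtain ⟨g, hgP, hgA, hgd⟩ := exists_disjoint_support_family (𝕜 := 𝕜) hκ hA₀
    (P := fun a => ‖L a‖ < K' * ellOneNorm a) (fun A hA => by
      by_contra! hcon
      exact hK'.not_ge (le_csSup hbdd ⟨A, hA, fun a ha => by
        by_contra! hlt
        exact hcon a hlt ha⟩))
  have hN : ∀ i, 0 < ellOneNorm (g i) := fun i =>
    pos_of_mul_pos_right ((norm_nonneg _).trans_lt (hgP i)) hK'0.le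
  let t : κ.ord.ToType → ℝ := fun i => (K' * ellOneNorm (g i))⁻¹
  have ht : ∀ i, 0 < t i := fun i => inv_pos.2 (mul_pos hK'0 (hN i))
  refine ⟨fun i => (t i : 𝕜) • L (g i), fun i => ?_, fun a => ?_⟩
  · rw [norm_smul, RCLike.norm_ofReal, abs_of_pos (ht i), inv_mul_le_one₀ (mul_pos hK'0 (hN i))]
    exact (hgP i).le
  · have h1 : Finsupp.linearCombination 𝕜 (fun i => (t i : 𝕜) • L (g i)) a =
        L (∑ i ∈ a.support, (a i * t i) • g i) := by
      rw [Finsupp.linearCombination_apply, Finsupp.sum, map_sum]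
      refine Finset.sum_congr rfl fun i _ => ?_
      rw [map_smul, mul_smul]
    have h2 : ellOneNorm (∑ i ∈ a.support, (a i * (t i : 𝕜)) • g i) = ellOneNorm a / K' := by
      rw [ellOneNorm_sum_smul hgd, ellOneNorm, Finset.sum_div]
      refine Finset.sum_congr rfl fun i _ => ?_
      rw [norm_mul, RCLike.norm_ofReal, abs_of_pos (ht i)]
      have := (hN i).ne'
      simp only [t]
      field_simp
    rw [h1]
    refine le_trans ?_ (hr _ (support_sum_smul_disjoint (fun i _ => hgA i) _))
    rw [h2, mul_div_assoc', le_div_iff₀ hK'0]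
    nlinarith [ellOneNorm_nonneg a]

lemma exists_ellOne_family {κ : Cardinal} (hX : ContainsIsomorph 𝕜 X (EllOne 𝕜 κ)) :
    ∃ (v : κ.ord.ToType → X) (m M : ℝ), 0 < m ∧
      (∀ a : κ.ord.ToType →₀ 𝕜, m * ellOneNorm a ≤ ‖Finsupp.linearCombination 𝕜 v a‖) ∧
      ∀ i, ‖v i‖ ≤ M := by
  classical
  obtain ⟨Y, -, ⟨T⟩⟩ := hX
  let V : EllOne 𝕜 κ →L[𝕜] X := Y.subtypeL.comp (T.symm : EllOne 𝕜 κ →L[𝕜] Y)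
  let e : κ.ord.ToType → EllOne 𝕜 κ := fun i => lp.single 1 i (1 : 𝕜)
  have he : ∀ a : κ.ord.ToType →₀ 𝕜, ‖Finsupp.linearCombination 𝕜 e a‖ = ellOneNorm a := by
    intro a
    have h := lp.norm_sum_single (p := 1) (E := fun _ : κ.ord.ToType => 𝕜) (by simp) a a.support
    simp only [ENNReal.toReal_one, Real.rpow_one] at h
    rw [ellOneNorm, ← h, Finsupp.linearCombination_apply, Finsupp.sum]
    congr 1
    refine Finset.sum_congr rfl fun i _ => ?_
    rw [← lp.single_smul, smul_eq_mul, mul_one]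
  refine ⟨fun i => V (e i), (‖(T : Y →L[𝕜] EllOne 𝕜 κ)‖ + 1)⁻¹, ‖V‖, by positivity,
    fun a => ?_, fun i => ?_⟩
  · rw [inv_mul_le_iff₀ (by positivity), ← he a]
    have h1 : Finsupp.linearCombination 𝕜 (fun i => V (e i)) a =
        V (Finsupp.linearCombination 𝕜 e a) := by
      simp [Finsupp.linearCombination_apply, Finsupp.sum]
    have h2 := (T : Y →L[𝕜] EllOne 𝕜 κ).le_opNorm (T.symm (Finsupp.linearCombination 𝕜 e a))
    rw [ContinuousLinearEquiv.coe_coe, T.apply_symm_apply] at h2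
    rw [h1]
    refine h2.trans ?_
    change _ * ‖V _‖ ≤ _ * ‖V _‖
    gcongr
    simp
  · refine (V.le_opNorm _).trans_eq ?_
    rw [lp.norm_single one_pos, norm_one, mul_one]

/-! ### Embedding the dual of `Z` into the dual of `X` -/

/-- The range of an operator that does not decrease norms is the required closed subspace. -/
lemma containsIsomorphWithConst_of_bounded_below {F G : Type*}
    [NormedAddCommGroup F] [NormedSpace 𝕜 F] [CompleteSpace F]
    [NormedAddCommGroup G] [NormedSpace 𝕜 G]
    (S : F →L[𝕜] G) {C : ℝ} (hS : ‖S‖ ≤ C) (hlow : ∀ x, ‖x‖ ≤ ‖S x‖) :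
    ContainsIsomorphWithConst 𝕜 C G F := by
  have hanti : AntilipschitzWith 1 S :=
    AddMonoidHomClass.antilipschitz_of_bound S (by simpa using hlow)
  have hC : 0 ≤ C := (norm_nonneg _).trans hS
  let e := LinearEquiv.ofInjective (S : F →ₗ[𝕜] G) hanti.injective
  have he : ∀ y, S (e.symm y) = y := fun y => congrArg Subtype.val (e.apply_symm_apply y)
  have h1 : ∀ y, ‖e.symm y‖ ≤ 1 * ‖y‖ := fun y => by
    rw [one_mul]
    refine (hlow _).trans_eq ?_
    rw [he]
    rfl
  have h2 : ∀ x, ‖e x‖ ≤ C * ‖x‖ := fun x => S.le_of_opNorm_le hS x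
  refine ⟨LinearMap.range (S : F →ₗ[𝕜] G), ?_,
    e.symm.toContinuousLinearEquivOfBounds 1 C h1 h2, ?_⟩
  · rw [LinearMap.coe_range]
    exact hanti.isClosed_range S.uniformContinuous
  · refine (mul_le_mul (ContinuousLinearMap.opNorm_le_bound _ zero_le_one h1)
      (ContinuousLinearMap.opNorm_le_bound _ hC h2) (norm_nonneg _) zero_le_one).trans_eq (one_mul C)

/-- Normalizing a dense family gives a family in the unit ball that computes the norm of each
functional. -/
lemma exists_norming_family {ι : Type*} {d : ι → Z} (hd : DenseRange d) :
    ∃ z : ι → Z, (∀ i, ‖z i‖ ≤ 1) ∧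
      ∀ (φ : StrongDual 𝕜 Z) (C : ℝ), 0 ≤ C → (∀ i, ‖φ (z i)‖ ≤ C) → ‖φ‖ ≤ C := by
  -- If `d i = 0`, then `‖d i‖⁻¹ = 0` and the normalized vector is `0`, which is harmless.
  refine ⟨fun i => ((‖d i‖⁻¹ : ℝ) : 𝕜) • d i, fun i => ?_, fun φ C hC h => ?_⟩
  · rw [norm_smul, RCLike.norm_ofReal, abs_of_nonneg (by positivity)]
    exact inv_mul_le_one
  · refine ContinuousLinearMap.opNorm_le_bound _ hC fun x => ?_
    refine hd.induction_on (p := fun x => ‖φ x‖ ≤ C * ‖x‖) x ?_ fun i => ?_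
    · exact isClosed_le (by fun_prop) (by fun_prop)
    · rcases eq_or_ne (d i) 0 with h0 | h0
      · simp [h0]
      · have := h i
        rw [map_smul, norm_smul, RCLike.norm_ofReal, abs_of_nonneg (by positivity),
          inv_mul_le_iff₀ (norm_pos_iff.2 h0)] at this
        linarith

/-- A family in `X` almost isometric to the basis of `ℓ¹_κ` is sent to a norming family of `Z`;
the adjoint of the extension `X → Z**`, restricted to `Z*`, embeds `Z*` into `X*`. -/
theorem containsIsomorphWithConst_of_bidualExtension {κ : Cardinal} (hκ : Cardinal.aleph0 ≤ κ)
    (hX : ContainsIsomorph 𝕜 X (EllOne 𝕜 κ)) (hext : BidualExtension 𝕜 X Z)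
    {d : κ.ord.ToType → Z} (hd : DenseRange d) {ε : ℝ} (hε : 0 < ε) :
    ContainsIsomorphWithConst 𝕜 (1 + ε) (StrongDual 𝕜 X) (StrongDual 𝕜 Z) := by
  obtain ⟨v, m, M, hm, hlow, hup⟩ := exists_ellOne_family hX
  have hε1 : 0 < 1 + ε := by linarith
  obtain ⟨y, hy, hylow⟩ := exists_almost_isometric_ellOne_family (𝕜 := 𝕜) hκ hm hlow hup
    (c := (1 + ε)⁻¹) (inv_lt_one_of_one_lt₀ (by linarith))
  obtain ⟨z, hz, hznorm⟩ := exists_norming_family (𝕜 := 𝕜) hd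
  let L := Finsupp.linearCombination 𝕜 y
  have hL : ∀ a, ellOneNorm a ≤ (1 + ε) * ‖L a‖ := fun a => by
    have := hylow a
    rwa [inv_mul_le_iff₀ hε1] at this
  have hinj : Function.Injective L := by
    rw [← LinearMap.ker_eq_bot, LinearMap.ker_eq_bot']
    intro a ha
    ext i
    have h1 := (norm_le_ellOneNorm a i).trans (hL a)
    rw [ha, norm_zero, mul_zero] at h1
    simpa using h1
  let e := LinearEquiv.ofInjective L hinj
  let q : LinearMap.range L →L[𝕜] Z :=
    ((Finsupp.linearCombination 𝕜 z).comp e.symm.toLinearMap).mkContinuous (1 + ε) (fun x => by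
      obtain ⟨a, rfl⟩ := e.surjective x
      refine le_trans ?_ (hL a)
      rw [LinearMap.comp_apply, LinearEquiv.coe_coe, e.symm_apply_apply,
        Finsupp.linearCombination_apply, Finsupp.sum, ellOneNorm]
      refine norm_sum_le_of_le _ fun i _ => ?_
      rw [norm_smul]
      exact mul_le_of_le_one_right (norm_nonneg _) (hz i))
  have hq : ∀ i, q (e (Finsupp.single i 1)) = z i := fun i => by
    simp [q]
  obtain ⟨S, hS, hSq⟩ := hext (LinearMap.range L) q
  refine containsIsomorphWithConst_of_bounded_below S
    (hS.trans (LinearMap.mkContinuous_norm_le _ hε1.le _)) fun φ => ?_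
  refine hznorm φ _ (norm_nonneg _) fun i => ?_
  have hei : ((e (Finsupp.single i 1) : LinearMap.range L) : X) = y i := by
    simp [e, L]
  have h1 := hSq φ (e (Finsupp.single i 1))
  rw [hq, hei] at h1
  rw [← h1]
  exact (S φ).le_of_opNorm_le_of_le le_rfl (hy i) |>.trans_eq (mul_one _)

lemma exists_denseRange_of_densityCharacter_le.{u, v} {Y : Type u} [TopologicalSpace Y] [Nonempty Y]
    {κ : Cardinal.{v}}
    (h : Cardinal.lift.{v} (densityCharacter Y) ≤ Cardinal.lift.{u} κ) :
    ∃ d : κ.ord.ToType → Y, DenseRange d := by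
  obtain ⟨s, hs, hcard⟩ : densityCharacter Y ∈
      {c : Cardinal.{u} | ∃ s : Set Y, Dense s ∧ Cardinal.mk s = c} :=
    csInf_mem ⟨_, Set.univ, dense_univ, rfl⟩
  rw [← hcard, ← Cardinal.mk_ord_toType κ, Cardinal.lift_mk_le'] at h
  obtain ⟨j⟩ := h
  have : Nonempty s := hs.nonempty.to_subtype
  refine ⟨fun i => (Function.invFun j i : s), ?_⟩
  exact hs.denseRange_val.comp (Function.invFun_surjective j.injective).denseRange
    continuous_subtype_val

end BanachEmb

theorem theorem15 {𝕜 : Type uK} [RCLike 𝕜]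
    (κ : Cardinal.{uκ}) (hκ : Cardinal.aleph0 ≤ κ)
    (X : Type uX) [NormedAddCommGroup X] [NormedSpace 𝕜 X] [CompleteSpace X]
    (hX : BanachEmb.ContainsIsomorph 𝕜 X (BanachEmb.EllOne 𝕜 κ)) :
    (∀ (Z : Type uZ) [NormedAddCommGroup Z] [NormedSpace 𝕜 Z] [CompleteSpace Z],
      BanachEmb.IsL1Predual.{uΩ} 𝕜 Z →
      Cardinal.lift.{uκ} (BanachEmb.densityCharacter Z) ≤ Cardinal.lift.{uZ} κ →
      ∀ ε : ℝ, 0 < ε →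
        BanachEmb.ContainsIsomorphWithConst 𝕜 (1 + ε) (StrongDual 𝕜 X) (StrongDual 𝕜 Z)) ∧
    (∀ ε : ℝ, 0 < ε →
      BanachEmb.ContainsIsomorphWithConst 𝕜 (1 + ε) (StrongDual 𝕜 X)
        (StrongDual 𝕜 C(BanachEmb.CantorCube κ, 𝕜))) := by
  constructor
  · rintro Z _ _ _ ⟨Ω, _, μ, ⟨I⟩⟩ hdens ε hε
    obtain ⟨d, hd⟩ := BanachEmb.exists_denseRange_of_densityCharacter_le hdens
    exact BanachEmb.containsIsomorphWithConst_of_bidualExtension hκ hX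
      (BanachEmb.bidualExtension_of_dual_isometric_L1 I) hd hε
  · intro ε hε
    have : Infinite κ.ord.ToType := by
      rwa [Cardinal.infinite_iff, Cardinal.mk_ord_toType]
    obtain ⟨d, hd⟩ := BanachEmb.exists_dense_range_continuousMap_cube (𝕜 := 𝕜) κ.ord.ToType
    exact BanachEmb.containsIsomorphWithConst_of_bidualExtension hκ hX
      (BanachEmb.bidualExtension_continuousMap_cube κ.ord.ToType) hd hε
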